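/- Let $[0,M]$ ($M>0$) be a line barrier on the $x$-axis, and let $n$ sensors be given, sensor $i$ having initial position $(x_i,y_i)\in\mathbb R^2$ and sensing radius $r_i\ge 0$; put $r_{\max}=\max_i r_i$. Let $D\ge 0$ be a real number. A sensor relocated to $(x_i',0)$ is moved by the distance $\sqrt{(x_i-x_i')^2+y_i^2}$ and covers the points of $[x_i'-r_i,x_i'+r_i]$. For each sensor $i$ that can cover at least one point of the barrier after a relocation within distance $D$ to the $x$-axis, let $l_i$ and $g_i$ be the leftmost and the rightmost point of the barrier that it can cover in this way. Let $V\subset[0,M]$ be a finite set containing $0$, $M$ and all these points $l_i,g_i$ (for instance exactly these points), and let $E$ be the set of edges, i.e. segments $e=[v,v']$ between consecutive points $v<v'$ of $V$, with length $|e|=v'-v$. The resulting instance of DMMSM is feasible under a relocation distance $B$ if some of the sensors can be relocated to positions on the $x$-axis, each being moved by at most $B$, so that every point of every edge of $E$ is covered by at least one relocated sensor (the other sensors are not used). Let $J_i$ be the set of edges contained in $[l_i,g_i]$ ($J_i=\emptyset$ if sensor $i$ cannot cover any point of the barrier within $D$), and let LP1 be the linear program $$\max\ \sum_{i}\sum_{e\in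 J_i}x_{i,e}$$ subject to $$\sum_{e\in J_i}x_{i,e}\le 2r_i\ \ (\forall i),\qquad \sum_{i:\,e\in J_i}x_{i,e}\le |e|\ \ (\forall e\in E),\qquad 0\le x_{i,e}\le|e|\ \ (\forall i,\ e\in J_i).$$ The algorithm computes an optimal solution of LP1 (one always exists) and returns "feasible" if its value equals $M$, and "infeasible" otherwise. **Theorem.** If the algorithm returns "infeasible", then the instance of DMMSM is infeasible under $D$. If it returns "feasible", then the instance of DMMSM is feasible under the relocation distance $D+r_{\max}$. More precisely, every optimal solution $\mathbf x$ of LP1 of value $M$ can be rounded to a cover of the barrier: $[0,M]$ can be tiled by segments, one segment for each sensor $i$ with $\sum_{e\in J_i}x_{i,e}>0$, of length $\sum_{e\in J_i}x_{i,e}$, with pairwise disjoint interiors, and each of these sensors can be relocated to the $x$-axis, being moved by at most $D+r_{\max}$, so that it covers its whole segment. -/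

import Mathlib

open Set

noncomputable section

/-- An instance of the sensor relocation problem: a barrier `[0, M]` on the `x`-axis and `n` sensors,
sensor `i` having initial position `(x i, y i)` in the plane and sensing radius `r i`. -/
structure BarrierInstance (n : ℕ) where
  M : ℝ
  M_pos : 0 < M
  x : Fin n → ℝ
  y : Fin n → ℝ
  r : Fin n → ℝ
  r_nonneg : ∀ i, 0 ≤ r i

open Classical in
/-- The edges of the path graph whose vertices are the points of `V`, i.e. the pairs of consecutive
points of `V` (from left to right). -/
def pathEdges (V : Finset ℝ) : Finset (ℝ × ℝ) :=
  (V ×ˢ V).filter fun e => e.1 < e.2 ∧ ∀ v ∈ V, ¬ (e.1 < v ∧ v < e.2)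

/-- The two possible answers of the decision algorithm. -/
inductive Answer
  | feasible
  | infeasible

namespace BarrierInstance

variable {n : ℕ}

/-- The maximum sensing radius. -/
def rmax (I : BarrierInstance n) : ℝ := ⨆ i, I.r i

/-- The Euclidean distance from the initial position of sensor `i` to the point `(p, 0)`. -/
def moveDist (I : BarrierInstance n) (i : Fin n) (p : ℝ) : ℝ :=
  √((I.x i - p) ^ 2 + (I.y i - 0) ^ 2)

/-- The points of the barrier that sensor `i` can cover after relocating within distance `D` to some
position `(q, 0)` on the line of the barrier. -/
def coverable (I : BarrierInstance n) (D : ℝ) (i : Fin n) : Set ℝ :=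
  {p | p ∈ Icc 0 I.M ∧ ∃ q : ℝ, I.moveDist i q ≤ D ∧ |p - q| ≤ I.r i}

/-- The leftmost point `lᵢ` of the barrier that sensor `i` can cover within distance `D`
(meaningful when there is such a point). -/
def leftmost (I : BarrierInstance n) (D : ℝ) (i : Fin n) : ℝ := sInf (I.coverable D i)

/-- The rightmost point `gᵢ` of the barrier that sensor `i` can cover within distance `D`
(meaningful when there is such a point). -/
def rightmost (I : BarrierInstance n) (D : ℝ) (i : Fin n) : ℝ := sSup (I.coverable D i)

open Classical in
/-- The vertices of the discretized instance for the bound `D`: the two ends of the barrier, and the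
points `lᵢ`, `gᵢ` of every sensor `i` that can cover some point of the barrier. -/
def vertices (I : BarrierInstance n) (D : ℝ) : Finset ℝ :=
  {0, I.M} ∪ (Finset.univ.filter fun i => (I.coverable D i).Nonempty).biUnion
    fun i => {I.leftmost D i, I.rightmost D i}

/-- Feasibility of the discretized problem with vertex set `V` under the relocation distance `D`:
some set `A` of sensors can be relocated to positions `(x' i, 0)`, each within distance `D`, such that
every point of every edge is within distance `r i` of some relocated sensor `i`.
The other sensors are not used. -/
def Feasible (I : BarrierInstance n) (V : Finset ℝ) (D : ℝ) : Prop :=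
  ∃ (A : Finset (Fin n)) (x' : Fin n → ℝ), (∀ i ∈ A, I.moveDist i (x' i) ≤ D) ∧
    ∀ e ∈ pathEdges V, ∀ p ∈ Icc e.1 e.2, ∃ i ∈ A, |p - x' i| ≤ I.r i

/-- If every sensor can reach the line of the barrier, it makes no difference whether all sensors have
to be relocated to the line or some may be left unused. -/
theorem feasible_iff_forall (I : BarrierInstance n) (V : Finset ℝ) (D : ℝ)
    (h : ∀ i, |I.y i| ≤ D) :
    I.Feasible V D ↔ ∃ x' : Fin n → ℝ, (∀ i, I.moveDist i (x' i) ≤ D) ∧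
      ∀ e ∈ pathEdges V, ∀ p ∈ Icc e.1 e.2, ∃ i, |p - x' i| ≤ I.r i := by
  classical
  constructor
  · rintro ⟨A, x', hA, hc⟩
    refine ⟨fun i => if i ∈ A then x' i else I.x i, fun i => ?_, fun e he p hp => ?_⟩
    · by_cases hi : i ∈ A
      · simpa [hi] using hA i hi
      · simpa [hi, moveDist, Real.sqrt_sq_eq_abs] using h i
    · obtain ⟨i, hi, hp⟩ := hc e he p hp
      exact ⟨i, by simpa [hi] using hp⟩
  · rintro ⟨x', hA, hc⟩
    refine ⟨Finset.univ, x', fun i _ => hA i, fun e he p hp => ?_⟩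
    obtain ⟨i, hi⟩ := hc e he p hp
    exact ⟨i, Finset.mem_univ i, hi⟩

open Classical in
/-- `Jᵢ`: the edges lying between `lᵢ` and `gᵢ`; none if sensor `i` cannot cover any point. -/
def J (I : BarrierInstance n) (V : Finset ℝ) (D : ℝ) (i : Fin n) : Finset (ℝ × ℝ) :=
  (pathEdges V).filter fun e =>
    (I.coverable D i).Nonempty ∧ I.leftmost D i ≤ e.1 ∧ e.2 ≤ I.rightmost D i

/-- The total length that sensor `i` covers according to the fractional solution `z`. -/
def load (I : BarrierInstance n) (V : Finset ℝ) (D : ℝ) (z : Fin n → ℝ × ℝ → ℝ) (i : Fin n) : ℝ :=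
  ∑ e ∈ I.J V D i, z i e

/-- The objective function of the linear program. -/
def lpValue (I : BarrierInstance n) (V : Finset ℝ) (D : ℝ) (z : Fin n → ℝ × ℝ → ℝ) : ℝ :=
  ∑ i, I.load V D z i

open Classical in
/-- The constraints of the linear program. The variables are the `z i e` with `e ∈ Jᵢ`; other values
of `z` are never used. -/
structure IsLPSolution (I : BarrierInstance n) (V : Finset ℝ) (D : ℝ)
    (z : Fin n → ℝ × ℝ → ℝ) : Prop where
  sensor : ∀ i, ∑ e ∈ I.J V D i, z i e ≤ 2 * I.r i
  edge : ∀ e ∈ pathEdges V, ∑ i with e ∈ I.J V D i, z i e ≤ e.2 - e.1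
  nonneg : ∀ i, ∀ e ∈ I.J V D i, 0 ≤ z i e
  le_length : ∀ i, ∀ e ∈ I.J V D i, z i e ≤ e.2 - e.1

/-- `z` is an optimal solution of the linear program. -/
def IsLPOptimal (I : BarrierInstance n) (V : Finset ℝ) (D : ℝ) (z : Fin n → ℝ × ℝ → ℝ) : Prop :=
  I.IsLPSolution V D z ∧ ∀ w, I.IsLPSolution V D w → I.lpValue V D w ≤ I.lpValue V D z

/-- `I.Returns V D a`: the decision algorithm can return the answer `a`. It computes some optimal
solution of the linear program, and answers "feasible" if its value is `M` and "infeasible"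
otherwise. -/
def Returns (I : BarrierInstance n) (V : Finset ℝ) (D : ℝ) (a : Answer) : Prop :=
  ∃ z, I.IsLPOptimal V D z ∧
    a = if I.lpValue V D z = I.M then Answer.feasible else Answer.infeasible

/-- The new positions `(x' i, 0)` and the segments `[s i, s i + load i]` form a rounding of the
fractional solution `z` with relocation distance at most `B`: the pieces of the barrier that `z`
assigns to sensor `i` are aggregated to one segment of the same total length, every sensor of positive
load is moved by at most `B` and monitors its whole segment, and the segments tile the barrier. -/
structure IsRounding (I : BarrierInstance n) (V : Finset ℝ) (D : ℝ) (z : Fin n → ℝ × ℝ → ℝ)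
    (B : ℝ) (x' s : Fin n → ℝ) : Prop where
  move : ∀ i, 0 < I.load V D z i → I.moveDist i (x' i) ≤ B
  monitor : ∀ i, 0 < I.load V D z i →
    Icc (s i) (s i + I.load V D z i) ⊆ Icc (x' i - I.r i) (x' i + I.r i)
  disjoint : ∀ i j, i ≠ j →
    Disjoint (Ioo (s i) (s i + I.load V D z i)) (Ioo (s j) (s j + I.load V D z j))
  cover : (⋃ i ∈ {i | 0 < I.load V D z i}, Icc (s i) (s i + I.load V D z i)) = Icc 0 I.M

end BarrierInstance

end

/-!
The value of the linear program is at most `M`, because the edges tile the barrier.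

*A feasible instance gives a fractional solution of value `M`.* Given relocated sensors covering the
barrier, assign every point to the first sensor that covers it, and let `z i e` be the length of the
part of `e` assigned to sensor `i`. If this part is nonempty, the sensor reaches an interior point of
`e`, so `e` lies between `lᵢ` and `gᵢ`, which are vertices
(`BarrierInstance.exists_isLPSolution_of_feasible`).

*A fractional solution of value `M` can be rounded.* Regard the sensors of positive load `Lᵢ` as jobs
with release times `lᵢ`, deadlines `gᵢ` and processing times `Lᵢ ≤ 2 * rmax`. The edge constraints say
that the jobs whose windows lie in `[a, b]` have total length at most `b - a`. Schedule the jobs without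
preemption and without idle time: at time `t`, among the remaining jobs with `lᵢ ≤ t + rmax`, process
one of earliest deadline. Every job then starts no earlier than `lᵢ - rmax`. It also ends no later than
`gᵢ + rmax`. For let `k` be a job, `j` the last job before `k` with a later deadline, and `t` the start
of `j`. The jobs after `j`, up to `k`, were not available at time `t`, so their windows lie in
`[t + rmax, gₖ]`, and they are finished by the time
`t + Lⱼ + (gₖ - t - rmax) ≤ gₖ + rmax`. If there is no such `j`, all windows of the jobs up to `k` lie
in `[0, gₖ]`, and `k` is finished by the time `gₖ`. This is carried out, as an induction on the set of remaining
jobs, in `exists_schedule`. A segment within `[lᵢ - rmax, gᵢ + rmax]` is covered by sensor `i` after a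
relocation by at most `D + rmax` (`BarrierInstance.exists_position`).
-/

open MeasureTheory

/-! ### Nonpreemptive scheduling with relaxed windows -/

/-- The greedy schedule from time `t` on, for a set `U` of jobs with windows `[l i, g i]`, lengths
`L i ≤ 2 * R` and total length `M - t`. The hypothesis on subsets `T` is the interval condition
satisfied by every preemptively feasible set of jobs. The hypothesis on jobs `k` is the invariant of
the greedy algorithm: the jobs with deadlines up to `g k` have total length at most `g k + R - t`. -/
theorem exists_schedule {ι : Type*} [DecidableEq ι] (L l g : ι → ℝ) (R M : ℝ) (U : Finset ι) :
    ∀ t : ℝ, (∀ i ∈ U, 0 < L i) → (∀ i ∈ U, L i ≤ 2 * R) → (∀ i ∈ U, g i ≤ M) →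
    (∀ T ⊆ U, T.Nonempty → ∀ a b, (∀ i ∈ T, a ≤ l i ∧ g i ≤ b) → ∑ i ∈ T, L i ≤ b - a) →
    (∀ k ∈ U, ∑ i ∈ U with g i ≤ g k, L i ≤ g k + R - t) →
    t + ∑ i ∈ U, L i = M →
    ∃ s : ι → ℝ, (∀ i ∈ U, t ≤ s i ∧ l i - R ≤ s i ∧ s i + L i ≤ g i + R) ∧
      (∀ i ∈ U, ∀ j ∈ U, i ≠ j → Disjoint (Ioo (s i) (s i + L i)) (Ioo (s j) (s j + L j))) ∧
      (⋃ i ∈ U, Ico (s i) (s i + L i)) = Ico t M := by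
  induction hn : U.card generalizing U with
  | zero =>
    intro t _ _ _ _ _ hM
    obtain rfl := Finset.card_eq_zero.mp hn
    refine ⟨fun _ => 0, by simp, by simp, ?_⟩
    simp only [Finset.sum_empty, add_zero] at hM
    simp [hM]
  | succ m ih =>
    intro t hpos hle hgM hint hdue hM
    have hne : U.Nonempty := Finset.card_pos.mp (by omega)
    -- Some job is available: otherwise all remaining work would have to fit into `[t + R, M]`.
    have hav : (U.filter fun i => l i ≤ t + R).Nonempty := by
      by_contra h
      rw [Finset.not_nonempty_iff_eq_empty, Finset.filter_eq_empty_iff] at h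
      have h1 := hint U subset_rfl hne (t + R) M
        fun i hi => ⟨(not_le.mp (h hi)).le, hgM i hi⟩
      obtain ⟨i, hi⟩ := hne
      have := hpos i hi
      have := hle i hi
      linarith
    obtain ⟨j, hj, hmin⟩ := Finset.exists_min_image _ g hav
    obtain ⟨hjU, hjl⟩ := Finset.mem_filter.mp hj
    have hsub : U.erase j ⊆ U := Finset.erase_subset _ _
    have hsum : L j + ∑ i ∈ U.erase j, L i = ∑ i ∈ U, L i := Finset.add_sum_erase _ _ hjU
    have hend : t + L j ≤ g j + R := by
      have h1 : L j ≤ ∑ i ∈ U with g i ≤ g j, L i :=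
        Finset.single_le_sum (f := L) (fun i hi => (hpos i (Finset.mem_filter.mp hi).1).le)
          (Finset.mem_filter.mpr ⟨hjU, le_rfl⟩)
      have := hdue j hjU
      linarith
    obtain ⟨s, hs, hdisj, hcov⟩ := ih (U.erase j) (by rw [Finset.card_erase_of_mem hjU]; omega)
      (t + L j) (fun i hi => hpos i (hsub hi)) (fun i hi => hle i (hsub hi))
      (fun i hi => hgM i (hsub hi)) (fun T hT => hint T (hT.trans hsub))
      (by
        intro k hk
        have hkU := hsub hk
        by_cases hjk : g j ≤ g k
        · have h1 := hdue k hkU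
          rw [← Finset.add_sum_erase (U.filter fun i => g i ≤ g k) L
            (Finset.mem_filter.mpr ⟨hjU, hjk⟩), ← Finset.filter_erase] at h1
          linarith
        · -- The jobs due before `j` are not yet available, so they fit into `[t + R, g k]`.
          have h1 := hint ((U.erase j).filter fun i => g i ≤ g k)
            ((Finset.filter_subset _ _).trans hsub) ⟨k, Finset.mem_filter.mpr ⟨hk, le_rfl⟩⟩
            (t + R) (g k) (by
              intro i hi
              obtain ⟨hi, hik⟩ := Finset.mem_filter.mp hi
              refine ⟨?_, hik⟩
              by_contra hil
              have := hmin i (Finset.mem_filter.mpr ⟨hsub hi, (not_le.mp hil).le⟩)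
              exact hjk (this.trans hik))
          have := hle j hjU
          linarith)
      (by linarith)
    have hsumnn : 0 ≤ ∑ i ∈ U.erase j, L i :=
      Finset.sum_nonneg fun i hi => (hpos i (hsub hi)).le
    have hLj := hpos j hjU
    have heq : ∀ i ∈ U.erase j, Function.update s j t i = s i := fun i hi =>
      Function.update_of_ne (Finset.ne_of_mem_erase hi) _ _
    have hfirst : ∀ i ∈ U.erase j,
        Disjoint (Ioo t (t + L j)) (Ioo (s i) (s i + L i)) := fun i hi =>
      Set.disjoint_left.mpr fun p hp hp' => absurd (hp.2.trans_le ((hs i hi).1.trans hp'.1.le))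
        (lt_irrefl _)
    refine ⟨Function.update s j t, fun i hi => ?_, fun i hi k hk hik => ?_, ?_⟩
    · by_cases hij : i = j
      · subst hij
        simp only [Function.update_self]
        exact ⟨le_rfl, by linarith, hend⟩
      · have hi' := Finset.mem_erase.mpr ⟨hij, hi⟩
        rw [heq i hi']
        obtain ⟨h1, h2, h3⟩ := hs i hi'
        exact ⟨by linarith, h2, h3⟩
    · by_cases hij : i = j
      · subst hij
        have hk' := Finset.mem_erase.mpr ⟨hik.symm, hk⟩
        rw [heq k hk', Function.update_self]
        exact hfirst k hk'
      · have hi' := Finset.mem_erase.mpr ⟨hij, hi⟩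
        rw [heq i hi']
        by_cases hkj : k = j
        · subst hkj
          rw [Function.update_self]
          exact (hfirst i hi').symm
        · have hk' := Finset.mem_erase.mpr ⟨hkj, hk⟩
          rw [heq k hk']
          exact hdisj i hi' k hk' hik
    · have h1 : (⋃ i ∈ U.erase j, Ico (Function.update s j t i) (Function.update s j t i + L i)) =
          Ico (t + L j) M := by
        rw [← hcov]
        exact iUnion₂_congr fun i hi => by rw [heq i hi]
      rw [← Finset.insert_erase hjU, Finset.set_biUnion_insert, h1, Function.update_self]
      exact Ico_union_Ico_eq_Ico (by linarith) (by linarith)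

/-! ### Edges of the path -/

theorem mem_pathEdges {V : Finset ℝ} {e : ℝ × ℝ} :
    e ∈ pathEdges V ↔ (e.1 ∈ V ∧ e.2 ∈ V) ∧ e.1 < e.2 ∧ ∀ v ∈ V, ¬ (e.1 < v ∧ v < e.2) := by
  simp [pathEdges]

theorem pathEdges_disjoint (V : Finset ℝ) :
    (pathEdges V : Set (ℝ × ℝ)).PairwiseDisjoint fun e => Ioo e.1 e.2 := by
  intro e he f hf hef
  refine Set.disjoint_left.mpr fun p hp hq => hef ?_
  obtain ⟨⟨he1, he2⟩, -, he⟩ := mem_pathEdges.mp he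
  obtain ⟨⟨hf1, hf2⟩, -, hf⟩ := mem_pathEdges.mp hf
  have a1 := hf _ he1
  have a2 := hf _ he2
  have b1 := he _ hf1
  have b2 := he _ hf2
  obtain ⟨hp1, hp2⟩ := hp
  obtain ⟨hq1, hq2⟩ := hq
  ext
  · refine le_antisymm ?_ ?_ <;> by_contra h
    · exact a1 ⟨by linarith, by linarith⟩
    · exact b1 ⟨by linarith, by linarith⟩
  · refine le_antisymm ?_ ?_ <;> by_contra h
    · exact b2 ⟨by linarith, by linarith⟩
    · exact a2 ⟨by linarith, by linarith⟩

theorem volume_real_Ioo_pathEdges {V : Finset ℝ} {e : ℝ × ℝ} (he : e ∈ pathEdges V) :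
    volume.real (Ioo e.1 e.2) = e.2 - e.1 :=
  Real.volume_real_Ioo_of_le (mem_pathEdges.mp he).2.1.le

/-- Edges contained in an interval have total length at most the length of the interval. -/
theorem sum_pathEdges_le {V : Finset ℝ} {F : Finset (ℝ × ℝ)} (hF : F ⊆ pathEdges V) {a b : ℝ}
    (hab : a ≤ b) (h : ∀ e ∈ F, a ≤ e.1 ∧ e.2 ≤ b) : ∑ e ∈ F, (e.2 - e.1) ≤ b - a := by
  calc ∑ e ∈ F, (e.2 - e.1) = ∑ e ∈ F, volume.real (Ioo e.1 e.2) :=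
        Finset.sum_congr rfl fun e he => (volume_real_Ioo_pathEdges (hF he)).symm
    _ = volume.real (⋃ e ∈ F, Ioo e.1 e.2) :=
        (measureReal_biUnion_finset ((pathEdges_disjoint V).subset (by exact_mod_cast hF))
          (fun _ _ => measurableSet_Ioo) fun _ _ => by simp).symm
    _ ≤ volume.real (Icc a b) := by
        refine measureReal_mono (iUnion₂_subset fun e he p hp => ?_) (by simp)
        exact ⟨(h e he).1.trans hp.1.le, hp.2.le.trans (h e he).2⟩
    _ = b - a := Real.volume_real_Icc_of_le hab

/-- The edges cover the interval between any two vertices. -/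
theorem le_sum_pathEdges {V : Finset ℝ} {a b : ℝ} (ha : a ∈ V) (hb : b ∈ V) (hab : a ≤ b) :
    b - a ≤ ∑ e ∈ pathEdges V, (e.2 - e.1) := by
  calc b - a = volume.real (Ico a b) := (Real.volume_real_Ico_of_le hab).symm
    _ ≤ volume.real (⋃ e ∈ pathEdges V, Ico e.1 e.2) := by
        refine measureReal_mono (fun p hp => ?_) ?_
        · obtain ⟨v, hv, hvmax⟩ := (V.filter fun v => v ≤ p).exists_max_image id
            ⟨a, Finset.mem_filter.mpr ⟨ha, hp.1⟩⟩
          obtain ⟨u, hu, humin⟩ := (V.filter fun v => p < v).exists_min_image id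
            ⟨b, Finset.mem_filter.mpr ⟨hb, hp.2⟩⟩
          obtain ⟨hvV, hvp⟩ := Finset.mem_filter.mp hv
          obtain ⟨huV, hup⟩ := Finset.mem_filter.mp hu
          refine mem_iUnion₂.mpr ⟨(v, u), mem_pathEdges.mpr
            ⟨⟨hvV, huV⟩, hvp.trans_lt hup, fun w hw hvw => ?_⟩, hvp, hup⟩
          rcases le_or_gt w p with hwp | hwp
          · exact absurd (hvmax w (Finset.mem_filter.mpr ⟨hw, hwp⟩)) (not_le.mpr hvw.1)
          · exact absurd (humin w (Finset.mem_filter.mpr ⟨hw, hwp⟩)) (not_le.mpr hvw.2)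
        · exact (measure_biUnion_lt_top (pathEdges V).finite_toSet fun _ _ => by simp).ne
    _ ≤ ∑ e ∈ pathEdges V, volume.real (Ico e.1 e.2) := measureReal_biUnion_finset_le _ _
    _ = ∑ e ∈ pathEdges V, (e.2 - e.1) := Finset.sum_congr rfl fun e he =>
        Real.volume_real_Ico_of_le (mem_pathEdges.mp he).2.1.le

namespace BarrierInstance

variable {n : ℕ}

/-! ### Reach of a sensor -/

theorem r_le_rmax (I : BarrierInstance n) (i : Fin n) : I.r i ≤ I.rmax :=
  le_ciSup (Set.finite_range I.r).bddAbove i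

theorem leftmost_le {I : BarrierInstance n} {D : ℝ} {i : Fin n} {p : ℝ}
    (hp : p ∈ I.coverable D i) : I.leftmost D i ≤ p :=
  csInf_le ⟨0, fun _ hq => hq.1.1⟩ hp

theorem le_rightmost {I : BarrierInstance n} {D : ℝ} {i : Fin n} {p : ℝ}
    (hp : p ∈ I.coverable D i) : p ≤ I.rightmost D i :=
  le_csSup ⟨I.M, fun _ hq => hq.1.2⟩ hp

theorem leftmost_nonneg {I : BarrierInstance n} {D : ℝ} {i : Fin n}
    (h : (I.coverable D i).Nonempty) : 0 ≤ I.leftmost D i :=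
  le_csInf h fun _ hq => hq.1.1

theorem rightmost_le {I : BarrierInstance n} {D : ℝ} {i : Fin n}
    (h : (I.coverable D i).Nonempty) : I.rightmost D i ≤ I.M :=
  csSup_le h fun _ hq => hq.1.2

theorem leftmost_mem_of_vertices_subset {I : BarrierInstance n} {D : ℝ} {V : Finset ℝ}
    (hV : I.vertices D ⊆ V) {i : Fin n} (h : (I.coverable D i).Nonempty) :
    I.leftmost D i ∈ V := by
  classical
  refine hV (Finset.mem_union_right _ (Finset.mem_biUnion.mpr ⟨i, ?_, ?_⟩)) <;> simp [h]

theorem rightmost_mem_of_vertices_subset {I : BarrierInstance n} {D : ℝ} {V : Finset ℝ}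
    (hV : I.vertices D ⊆ V) {i : Fin n} (h : (I.coverable D i).Nonempty) :
    I.rightmost D i ∈ V := by
  classical
  refine hV (Finset.mem_union_right _ (Finset.mem_biUnion.mpr ⟨i, ?_, ?_⟩)) <;> simp [h]

theorem mem_J {I : BarrierInstance n} {V : Finset ℝ} {D : ℝ} {i : Fin n} {e : ℝ × ℝ} :
    e ∈ I.J V D i ↔ e ∈ pathEdges V ∧
      (I.coverable D i).Nonempty ∧ I.leftmost D i ≤ e.1 ∧ e.2 ≤ I.rightmost D i := by
  simp [J]

/-- An edge with an interior point that sensor `i` can cover lies between `lᵢ` and `gᵢ`. -/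
theorem mem_J_of_mem_coverable {I : BarrierInstance n} {D : ℝ} {V : Finset ℝ}
    (hV : I.vertices D ⊆ V) {i : Fin n} {e : ℝ × ℝ} (he : e ∈ pathEdges V) {p : ℝ}
    (hp : p ∈ I.coverable D i) (hpe : p ∈ Ioo e.1 e.2) : e ∈ I.J V D i := by
  have hne : (I.coverable D i).Nonempty := ⟨p, hp⟩
  have hcons := (mem_pathEdges.mp he).2.2
  refine mem_J.mpr ⟨he, hne, ?_, ?_⟩ <;> by_contra h
  · exact hcons _ (leftmost_mem_of_vertices_subset hV hne)
      ⟨not_le.mp h, (leftmost_le hp).trans_lt hpe.2⟩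
  · exact hcons _ (rightmost_mem_of_vertices_subset hV hne)
      ⟨hpe.1.trans_le (le_rightmost hp), not_le.mp h⟩

/-- A segment of length at most `2 * r i` within `[lᵢ - rmax, gᵢ + rmax]` is covered by sensor `i`
after a relocation by at most `D + rmax`. -/
theorem exists_position (I : BarrierInstance n) {D : ℝ} (hD : 0 ≤ D) {i : Fin n}
    (hne : (I.coverable D i).Nonempty) {s L : ℝ} (hL : L ≤ 2 * I.r i)
    (hs : I.leftmost D i - I.rmax ≤ s) (hs' : s + L ≤ I.rightmost D i + I.rmax) :
    ∃ x', I.moveDist i x' ≤ D + I.rmax ∧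
      Icc s (s + L) ⊆ Icc (x' - I.r i) (x' + I.r i) := by
  have hR : 0 ≤ I.rmax := (I.r_nonneg i).trans (I.r_le_rmax i)
  -- `h` is the largest horizontal displacement within distance `D`.
  set h := √(D ^ 2 - I.y i ^ 2) with hh
  have hreach : ∀ q, I.moveDist i q ≤ D → |I.x i - q| ≤ h := fun q hq => by
    rw [moveDist, Real.sqrt_le_left hD] at hq
    exact Real.abs_le_sqrt (by linarith)
  have hy : I.y i ^ 2 ≤ D ^ 2 := by
    obtain ⟨p, -, q, hq, -⟩ := hne
    rw [moveDist, Real.sqrt_le_left hD] at hq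
    nlinarith [sq_nonneg (I.x i - q)]
  have hl : I.x i - h - I.r i ≤ I.leftmost D i := le_csInf hne fun p ⟨_, q, hq, hpq⟩ => by
    have h1 := abs_le.mp (hreach q hq)
    have h2 := abs_le.mp hpq
    linarith
  have hg : I.rightmost D i ≤ I.x i + h + I.r i := csSup_le hne fun p ⟨_, q, hq, hpq⟩ => by
    have h1 := abs_le.mp (hreach q hq)
    have h2 := abs_le.mp hpq
    linarith
  have hh0 : 0 ≤ h := Real.sqrt_nonneg _
  have hh2 : h ^ 2 = D ^ 2 - I.y i ^ 2 := Real.sq_sqrt (by linarith)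
  have hhD : h ≤ D := by
    rw [hh, Real.sqrt_le_left hD]
    nlinarith [sq_nonneg (I.y i)]
  -- The position of `[s + L - r i, s + r i]` nearest to the initial one.
  refine ⟨max (s + L - I.r i) (min (s + I.r i) (I.x i)), ?_, Icc_subset_Icc ?_ ?_⟩
  · set x' := max (s + L - I.r i) (min (s + I.r i) (I.x i)) with hx'
    have h1 : |I.x i - x'| ≤ h + I.rmax := by
      rw [abs_le]
      constructor
      · have : x' ≤ I.x i + (h + I.rmax) :=
          max_le (by linarith) ((min_le_right _ _).trans (by linarith))
        linarith
      · have : I.x i - (h + I.rmax) ≤ x' :=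
          (le_min (by linarith) (by linarith)).trans (le_max_right _ _)
        linarith
    have h2 : (I.x i - x') ^ 2 ≤ (h + I.rmax) ^ 2 := sq_le_sq' (abs_le.mp h1).1 (abs_le.mp h1).2
    rw [moveDist, Real.sqrt_le_left (by linarith)]
    nlinarith [mul_le_mul_of_nonneg_right hhD hR]
  · have : max (s + L - I.r i) (min (s + I.r i) (I.x i)) ≤ s + I.r i :=
      max_le (by linarith) (min_le_left _ _)
    linarith
  · have := le_max_left (s + L - I.r i) (min (s + I.r i) (I.x i))
    linarith

/-! ### The linear program -/

theorem IsLPSolution.load_nonneg {I : BarrierInstance n} {V : Finset ℝ} {D : ℝ}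
    {z : Fin n → ℝ × ℝ → ℝ} (hz : I.IsLPSolution V D z) (i : Fin n) : 0 ≤ I.load V D z i :=
  Finset.sum_nonneg (hz.nonneg i)

/-- The sensors with windows in `[a, b]` have total load at most `b - a`. -/
theorem IsLPSolution.sum_load_le {I : BarrierInstance n} {V : Finset ℝ} {D : ℝ}
    {z : Fin n → ℝ × ℝ → ℝ} (hz : I.IsLPSolution V D z) (T : Finset (Fin n)) {a b : ℝ}
    (hab : a ≤ b)
    (hT : ∀ i ∈ T, (I.coverable D i).Nonempty → a ≤ I.leftmost D i ∧ I.rightmost D i ≤ b) :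
    ∑ i ∈ T, I.load V D z i ≤ b - a := by
  classical
  have hJ : ∀ i ∈ T, I.J V D i ⊆ (pathEdges V).filter fun e => a ≤ e.1 ∧ e.2 ≤ b := by
    intro i hi e he
    obtain ⟨h1, h2, h3, h4⟩ := mem_J.mp he
    obtain ⟨h5, h6⟩ := hT i hi h2
    exact Finset.mem_filter.mpr ⟨h1, h5.trans h3, h4.trans h6⟩
  calc ∑ i ∈ T, I.load V D z i
      = ∑ i ∈ T, ∑ e ∈ (pathEdges V).filter (fun e => a ≤ e.1 ∧ e.2 ≤ b),
          if e ∈ I.J V D i then z i e else 0 := by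
        refine Finset.sum_congr rfl fun i hi => ?_
        rw [Finset.sum_ite_mem, Finset.inter_eq_right.mpr (hJ i hi)]
        rfl
    _ = ∑ e ∈ (pathEdges V).filter (fun e => a ≤ e.1 ∧ e.2 ≤ b), ∑ i ∈ T,
          if e ∈ I.J V D i then z i e else 0 := Finset.sum_comm
    _ ≤ ∑ e ∈ (pathEdges V).filter (fun e => a ≤ e.1 ∧ e.2 ≤ b), (e.2 - e.1) := by
        refine Finset.sum_le_sum fun e he => ?_
        refine le_trans ?_ (hz.edge e (Finset.mem_filter.mp he).1)
        rw [Finset.sum_filter]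
        refine (Finset.sum_le_sum_of_subset_of_nonneg (Finset.subset_univ T) fun i _ _ => ?_).trans
          (le_of_eq (Finset.sum_congr rfl fun i _ => by congr))
        split_ifs with h
        exacts [hz.nonneg i e h, le_rfl]
    _ ≤ b - a := sum_pathEdges_le (Finset.filter_subset _ _) hab
        fun e he => (Finset.mem_filter.mp he).2

theorem IsLPSolution.lpValue_le {I : BarrierInstance n} {V : Finset ℝ} {D : ℝ}
    {z : Fin n → ℝ × ℝ → ℝ} (hz : I.IsLPSolution V D z) : I.lpValue V D z ≤ I.M := by
  have := hz.sum_load_le Finset.univ I.M_pos.le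
    fun i _ h => ⟨leftmost_nonneg h, rightmost_le h⟩
  simpa [lpValue] using this

/-- The optimum is attained, since the variables that matter range over a compact box. -/
theorem exists_isLPOptimal (I : BarrierInstance n) (V : Finset ℝ) (D : ℝ) :
    ∃ z, I.IsLPOptimal V D z := by
  classical
  -- Variables outside of the program are set to zero to make the box compact.
  set K : Set (Fin n → ℝ × ℝ → ℝ) :=
    univ.pi fun i => univ.pi fun e => Icc 0 (if e ∈ I.J V D i then e.2 - e.1 else 0) with hK
  have hKc : IsCompact K := isCompact_univ_pi fun i => isCompact_univ_pi fun e => isCompact_Icc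
  have hcont : ∀ i e, Continuous fun z : Fin n → ℝ × ℝ → ℝ => z i e := fun i e => by fun_prop
  set P : Set (Fin n → ℝ × ℝ → ℝ) := {z | I.IsLPSolution V D z} with hP
  have hPc : IsClosed P := by
    have : P = (⋂ i, {z | ∑ e ∈ I.J V D i, z i e ≤ 2 * I.r i}) ∩
        (⋂ e ∈ pathEdges V, {z | ∑ i with e ∈ I.J V D i, z i e ≤ e.2 - e.1}) ∩
        (⋂ i, ⋂ e ∈ I.J V D i, {z | 0 ≤ z i e}) ∩
        (⋂ i, ⋂ e ∈ I.J V D i, {z | z i e ≤ e.2 - e.1}) := by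
      ext z
      simp only [hP, mem_ofPred_eq, mem_inter_iff, mem_iInter]
      constructor
      · rintro ⟨h1, h2, h3, h4⟩
        exact ⟨⟨⟨h1, fun e he => by convert h2 e he⟩, h3⟩, h4⟩
      · rintro ⟨⟨⟨h1, h2⟩, h3⟩, h4⟩
        exact ⟨h1, fun e he => by convert h2 e he, h3, h4⟩
    rw [this]
    refine (((isClosed_iInter fun i => ?_).inter (isClosed_biInter fun e _ => ?_)).inter
      (isClosed_iInter fun i => isClosed_biInter fun e _ => ?_)).inter
      (isClosed_iInter fun i => isClosed_biInter fun e _ => ?_)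
    · exact isClosed_le (continuous_finsetSum _ fun e _ => hcont i e) continuous_const
    · exact isClosed_le (continuous_finsetSum _ fun i _ => hcont i e) continuous_const
    · exact isClosed_le continuous_const (hcont i e)
    · exact isClosed_le (hcont i e) continuous_const
  have hlen : ∀ i, ∀ e ∈ I.J V D i, 0 ≤ e.2 - e.1 := fun i e he =>
    sub_nonneg.mpr (mem_pathEdges.mp (mem_J.mp he).1).2.1.le
  have h0 : (0 : Fin n → ℝ × ℝ → ℝ) ∈ K ∩ P := by
    refine ⟨fun i _ e _ => ⟨le_rfl, ?_⟩, ?_, ?_, ?_, ?_⟩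
    · split_ifs with h
      exacts [hlen i e h, le_rfl]
    · intro i
      simpa using I.r_nonneg i
    · intro e he
      simpa using (mem_pathEdges.mp he).2.1.le
    · simp
    · intro i e he
      simpa using hlen i e he
  obtain ⟨z, hz, hmax⟩ := (hKc.inter_right hPc).exists_isMaxOn ⟨0, h0⟩
    (f := fun z => I.lpValue V D z) (by
      unfold lpValue load
      exact (continuous_finsetSum _ fun i _ =>
        continuous_finsetSum _ fun e _ => hcont i e).continuousOn)
  refine ⟨z, hz.2, fun w hw => ?_⟩
  let w' : Fin n → ℝ × ℝ → ℝ := fun i e => if e ∈ I.J V D i then w i e else 0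
  have hww : ∀ i, ∀ e ∈ I.J V D i, w' i e = w i e := fun i e he => if_pos he
  have hload : ∀ i, ∑ e ∈ I.J V D i, w' i e = ∑ e ∈ I.J V D i, w i e := fun i =>
    Finset.sum_congr rfl (hww i)
  have hw' : w' ∈ K ∩ P := by
    refine ⟨fun i _ e _ => ?_, fun i => ?_, fun e he => ?_, fun i e he => ?_, fun i e he => ?_⟩
    · by_cases h : e ∈ I.J V D i
      · simpa [w', h] using ⟨hw.nonneg i e h, hw.le_length i e h⟩
      · simp [w', h]
    · rw [hload i]
      exact hw.sensor i
    · refine le_trans (le_of_eq (Finset.sum_congr rfl fun i hi => ?_)) (hw.edge e he)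
      exact hww i e (Finset.mem_filter.mp hi).2
    · rw [hww i e he]
      exact hw.nonneg i e he
    · rw [hww i e he]
      exact hw.le_length i e he
  calc I.lpValue V D w = I.lpValue V D w' := Finset.sum_congr rfl fun i _ => (hload i).symm
    _ ≤ I.lpValue V D z := hmax hw'

/-- A cover of the barrier within distance `D` gives a fractional solution of value `M`: every point
is assigned to the first sensor that covers it. -/
theorem exists_isLPSolution_of_feasible {I : BarrierInstance n} {D : ℝ} {V : Finset ℝ}
    (hV : I.vertices D ⊆ V) (hVM : ∀ v ∈ V, v ∈ Icc 0 I.M) (h : I.Feasible V D) :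
    ∃ w, I.IsLPSolution V D w ∧ I.lpValue V D w = I.M := by
  classical
  obtain ⟨A, x', hA, hcov⟩ := h
  set c : Fin n → Set ℝ := fun i =>
    if i ∈ A then Icc (x' i - I.r i) (x' i + I.r i) else ∅ with hc
  have hcm : ∀ i, MeasurableSet (c i) := fun i => by
    simp only [hc]
    split_ifs
    exacts [measurableSet_Icc, MeasurableSet.empty]
  have hcfin : ∀ i, volume (c i) ≠ ⊤ := fun i => by
    simp only [hc]
    split_ifs <;> simp
  have hcvol : ∀ i, volume.real (c i) ≤ 2 * I.r i := fun i => by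
    have := I.r_nonneg i
    simp only [hc]
    split_ifs
    · rw [Real.volume_real_Icc_of_le (by linarith)]
      linarith
    · simpa using this
  set B : Fin n → Set ℝ := disjointed c with hB
  have hBc : ∀ i, B i ⊆ c i := fun i => disjointed_subset c i
  have hBm : ∀ i, MeasurableSet (B i) := fun i => by
    rw [hB, disjointed_apply, Finset.sup_eq_iSup]
    exact (hcm i).diff (Finset.measurableSet_biUnion _ fun j _ => hcm j)
  have hBd : Pairwise (Function.onFun Disjoint B) := disjoint_disjointed c
  have hBU : (⋃ i, B i) = ⋃ i, c i := iUnion_disjointed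
  set w : Fin n → ℝ × ℝ → ℝ := fun i e => volume.real (B i ∩ Ioo e.1 e.2) with hw
  have hzero : ∀ i, ∀ e ∈ pathEdges V, e ∉ I.J V D i → w i e = 0 := by
    intro i e he hJ
    have : B i ∩ Ioo e.1 e.2 = ∅ := by
      refine Set.eq_empty_of_forall_notMem fun p ⟨hpB, hpe⟩ => hJ ?_
      have hpc := hBc i hpB
      simp only [hc] at hpc
      split_ifs at hpc with hi
      · refine mem_J_of_mem_coverable hV he ⟨?_, x' i, hA i hi, ?_⟩ hpe
        · obtain ⟨h1, h2⟩ := (mem_pathEdges.mp he).1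
          exact ⟨(hVM _ h1).1.trans hpe.1.le, hpe.2.le.trans (hVM _ h2).2⟩
        · rw [abs_le]
          constructor <;> linarith [hpc.1, hpc.2]
      · exact absurd hpc (Set.notMem_empty p)
    simp [hw, this]
  have hedge : ∀ e ∈ pathEdges V, ∑ i, w i e = e.2 - e.1 := by
    intro e he
    rw [← volume_real_Ioo_pathEdges he]
    have h1 : (⋃ i ∈ (Finset.univ : Finset (Fin n)), B i ∩ Ioo e.1 e.2) = Ioo e.1 e.2 := by
      simp only [Finset.mem_univ, iUnion_true]
      rw [← iUnion_inter, hBU]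
      refine Set.inter_eq_right.mpr fun p hp => ?_
      obtain ⟨i, hi, hpi⟩ := hcov e he p (Ioo_subset_Icc_self hp)
      rw [abs_le] at hpi
      refine mem_iUnion.mpr ⟨i, ?_⟩
      simp only [hc, if_pos hi]
      constructor <;> linarith [hpi.1, hpi.2]
    conv_rhs => rw [← h1]
    refine (measureReal_biUnion_finset (fun i _ j _ hij => ?_)
      (fun i _ => (hBm i).inter measurableSet_Ioo) fun i _ => ?_).symm
    · exact (hBd hij).mono inter_subset_left inter_subset_left
    · exact measure_ne_top_of_subset inter_subset_right (by simp)
  have hJE : ∀ i, I.J V D i ⊆ pathEdges V := fun i e he => (mem_J.mp he).1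
  refine ⟨w, ⟨fun i => ?_, fun e he => ?_, fun i e _ => measureReal_nonneg, fun i e he => ?_⟩, ?_⟩
  · calc ∑ e ∈ I.J V D i, w i e = volume.real (⋃ e ∈ I.J V D i, B i ∩ Ioo e.1 e.2) := by
          refine (measureReal_biUnion_finset (fun e he f hf hef => ?_)
            (fun e _ => (hBm i).inter measurableSet_Ioo) fun e _ => ?_).symm
          · exact (pathEdges_disjoint V (hJE i he) (hJE i hf) hef).mono
              inter_subset_right inter_subset_right
          · exact measure_ne_top_of_subset inter_subset_right (by simp)
      _ ≤ volume.real (c i) := measureReal_mono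
          (iUnion₂_subset fun e _ => inter_subset_left.trans (hBc i)) (hcfin i)
      _ ≤ 2 * I.r i := hcvol i
  · rw [← hedge e he]
    exact Finset.sum_le_sum_of_subset_of_nonneg (Finset.filter_subset _ _)
      fun i _ _ => measureReal_nonneg
  · rw [← volume_real_Ioo_pathEdges (hJE i he)]
    exact measureReal_mono inter_subset_right (by simp)
  · have h1 : I.lpValue V D w = ∑ e ∈ pathEdges V, (e.2 - e.1) := by
      rw [← Finset.sum_congr rfl hedge, Finset.sum_comm]
      exact Finset.sum_congr rfl fun i _ => Finset.sum_subset (hJE i) (hzero i)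
    rw [h1]
    have h0V : (0 : ℝ) ∈ V := hV (by simp [vertices])
    have hMV : I.M ∈ V := hV (by simp [vertices])
    refine le_antisymm ?_ ?_
    · have := sum_pathEdges_le (subset_refl (pathEdges V)) I.M_pos.le fun e he =>
        ⟨(hVM _ (mem_pathEdges.mp he).1.1).1, (hVM _ (mem_pathEdges.mp he).1.2).2⟩
      linarith
    · have := le_sum_pathEdges h0V hMV I.M_pos.le
      linarith

/-! ### Rounding -/

theorem IsLPSolution.exists_isRounding {I : BarrierInstance n} {D : ℝ} (hD : 0 ≤ D)
    {V : Finset ℝ} {z : Fin n → ℝ × ℝ → ℝ} (hz : I.IsLPSolution V D z)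
    (hM : I.lpValue V D z = I.M) :
    ∃ x' s : Fin n → ℝ, I.IsRounding V D z (D + I.rmax) x' s := by
  classical
  set L := I.load V D z with hL
  set U : Finset (Fin n) := Finset.univ.filter fun i => 0 < L i with hU
  have hmem : ∀ {i}, i ∈ U ↔ 0 < L i := by simp [hU]
  have hne : ∀ i ∈ U, (I.coverable D i).Nonempty := fun i hi => by
    obtain ⟨e, he, -⟩ := Finset.exists_ne_zero_of_sum_ne_zero (hmem.mp hi).ne'
    exact (mem_J.mp he).2.1
  have hwin : ∀ i ∈ U, I.leftmost D i ≤ I.rightmost D i := fun i hi => by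
    obtain ⟨p, hp⟩ := hne i hi
    exact (leftmost_le hp).trans (le_rightmost hp)
  have hLr : ∀ i, L i ≤ 2 * I.r i := hz.sensor
  have hint : ∀ T ⊆ U, T.Nonempty → ∀ a b,
      (∀ i ∈ T, a ≤ I.leftmost D i ∧ I.rightmost D i ≤ b) → ∑ i ∈ T, L i ≤ b - a := by
    rintro T hT ⟨i, hi⟩ a b h
    exact hz.sum_load_le T ((h i hi).1.trans ((hwin i (hT hi)).trans (h i hi).2))
      fun i hi _ => h i hi
  have hsum : ∑ i ∈ U, L i = I.M := by
    rw [← hM, lpValue, hU, Finset.sum_filter]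
    refine Finset.sum_congr rfl fun i _ => ?_
    split_ifs with h
    · rfl
    · exact le_antisymm (hz.load_nonneg i) (not_lt.mp h)
  obtain ⟨s, hs, hdisj, hcov⟩ := exists_schedule L (I.leftmost D) (I.rightmost D) I.rmax I.M U 0
    (fun i hi => hmem.mp hi) (fun i _ => by linarith [hLr i, I.r_le_rmax i])
    (fun i hi => rightmost_le (hne i hi)) hint
    (fun k hk => by
      have h1 := hint (U.filter fun i => I.rightmost D i ≤ I.rightmost D k)
        (Finset.filter_subset _ _) ⟨k, Finset.mem_filter.mpr ⟨hk, le_rfl⟩⟩ 0 (I.rightmost D k)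
        fun i hi => ⟨leftmost_nonneg (hne i (Finset.mem_filter.mp hi).1),
          (Finset.mem_filter.mp hi).2⟩
      have := (I.r_nonneg k).trans (I.r_le_rmax k)
      linarith)
    (by rw [hsum, zero_add])
  have hpos : ∀ i, ∃ p, i ∈ U → I.moveDist i p ≤ D + I.rmax ∧
      Icc (s i) (s i + L i) ⊆ Icc (p - I.r i) (p + I.r i) := fun i => by
    by_cases hi : i ∈ U
    · obtain ⟨p, hp⟩ := I.exists_position hD (hne i hi) (hLr i) (hs i hi).2.1 (hs i hi).2.2
      exact ⟨p, fun _ => hp⟩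
    · exact ⟨0, fun h => absurd h hi⟩
  choose x' hx' using hpos
  refine ⟨x', s, fun i hi => (hx' i (hmem.mpr hi)).1, fun i hi => (hx' i (hmem.mpr hi)).2,
    fun i j hij => ?_, ?_⟩
  · have hempty : ∀ k ∉ U, Ioo (s k) (s k + L k) = ∅ := fun k hk =>
      Ioo_eq_empty (by rw [hmem] at hk; linarith)
    by_cases hi : i ∈ U
    · by_cases hj : j ∈ U
      · exact hdisj i hi j hj hij
      · rw [← hL, hempty j hj]
        exact disjoint_bot_right
    · rw [← hL, hempty i hi]
      exact disjoint_bot_left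
  · -- Half-open segments tile `[0, M)`; pass to closures.
    have h1 : closure (⋃ i ∈ U, Ico (s i) (s i + L i)) = ⋃ i ∈ U, Icc (s i) (s i + L i) := by
      rw [Finset.closure_biUnion]
      refine iUnion₂_congr fun i hi => closure_Ico ?_
      have := hmem.mp hi
      linarith
    rw [hcov, closure_Ico I.M_pos.ne] at h1
    rw [h1]
    exact iUnion_congr fun i => by simp only [mem_ofPred_eq, hmem, ← hL]

theorem IsRounding.feasible {I : BarrierInstance n} {D B : ℝ} {V : Finset ℝ}
    (hVM : ∀ v ∈ V, v ∈ Icc 0 I.M) {z : Fin n → ℝ × ℝ → ℝ} {x' s : Fin n → ℝ}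
    (h : I.IsRounding V D z B x' s) : I.Feasible V B := by
  classical
  refine ⟨Finset.univ.filter fun i => 0 < I.load V D z i, x',
    fun i hi => h.move i (Finset.mem_filter.mp hi).2, fun e he p hp => ?_⟩
  obtain ⟨h1, h2⟩ := (mem_pathEdges.mp he).1
  have hpM : p ∈ Icc 0 I.M := ⟨(hVM _ h1).1.trans hp.1, hp.2.trans (hVM _ h2).2⟩
  rw [← h.cover] at hpM
  obtain ⟨i, hi, hpi⟩ := mem_iUnion₂.mp hpM
  have hp' := h.monitor i hi hpi
  refine ⟨i, Finset.mem_filter.mpr ⟨Finset.mem_univ i, hi⟩, ?_⟩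
  rw [abs_le]
  constructor <;> linarith [hp'.1, hp'.2]

end BarrierInstance

theorem mainTheorem2 {n : ℕ} (I : BarrierInstance n) (D : ℝ) (hD : 0 ≤ D) (V : Finset ℝ)
    (hV : I.vertices D ⊆ V) (hVM : ∀ v ∈ V, v ∈ Set.Icc 0 I.M) :
    (∃ a, I.Returns V D a) ∧
    (I.Returns V D Answer.infeasible → ¬ I.Feasible V D) ∧
    (I.Returns V D Answer.feasible → I.Feasible V (D + I.rmax)) ∧
    (∀ z, I.IsLPOptimal V D z → I.lpValue V D z = I.M →
      ∃ x' s : Fin n → ℝ, I.IsRounding V D z (D + I.rmax) x' s) := by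
  refine ⟨?_, ?_, ?_, fun z hz hM => hz.1.exists_isRounding hD hM⟩
  · obtain ⟨z, hz⟩ := I.exists_isLPOptimal V D
    exact ⟨_, z, hz, rfl⟩
  · rintro ⟨z, hz, ha⟩ hfeas
    obtain ⟨w, hw, hwM⟩ := BarrierInstance.exists_isLPSolution_of_feasible hV hVM hfeas
    have hzM : I.lpValue V D z = I.M := le_antisymm hz.1.lpValue_le (hwM ▸ hz.2 w hw)
    rw [if_pos hzM] at ha
    cases ha
  · rintro ⟨z, hz, ha⟩
    have hzM : I.lpValue V D z = I.M := by
      by_contra h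
      rw [if_neg h] at ha
      cases ha
    obtain ⟨x', s, h⟩ := hz.1.exists_isRounding hD hzM
    exact h.feasible hVM
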